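/- Let $n$ be a positive integer, $\langle n\rangle=\{1,\dots,n\}$. A real $n\times n$ matrix $X$ is an M-matrix if $X=\alpha I-P$ with $P$ entrywise nonnegative and $\alpha\ge\rho(P)$, the spectral radius of $P$. The directed graph $\mathcal G(X)$ has vertex set $\langle n\rangle$ and an edge $(i,j)$ whenever $x_{ij}\ne 0$; $i$ has access to $j$ if there is a (possibly empty) path from $i$ to $j$; the classes of $X$ are the equivalence classes of mutual access, and a class $S$ is singular if the principal submatrix $X_{SS}$ is singular. A partition of $\langle n\rangle$ into nonempty blocks $(\upsilon_1,\dots,\upsilon_r)$ is order preserving if $i<j$, $i\in\upsilon_k$, $j\in\upsilon_l$ imply $k\le l$. A partition $\Psi$ is a refinement of an order preserving partition $\Upsilon$ (possibly equal to it) if $\Psi$ is order preserving and every block of $\Psi$ is contained in a block of $\Upsilon$. Let $\upsilon^+=\{l\in\langle n\rangle: l>\max\upsilon\}$. The block lower (respectively upper) triangular self-partition of $X$ is the finest order preserving partition such that $X_{\upsilon\,\upsilon^+}=0$ (respectively $X_{\upsilon^+\,\upsilon}=0$) for each of its blocks $\upsilon$. The finest order preserving partition encompassing a family of subsets of $\langle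 n\rangle$ is the finest order preserving partition such that each set of the family is contained in one of its blocks. (In each case "finest" means the greatest lower bound, with respect to refinement, of all order preserving partitions with the stated property.) **Theorem (Existence).** Let $A$ be an $n\times n$ M-matrix with singular classes $S_1,\dots,S_m$, ordered so that $\mu_i=\max S_i$ is strictly increasing in $i$. For $i\in\langle m\rangle$ put $$F_i=\{l\ge\mu_i : \text{some } j\ge l \text{ is accessed from } S_i \text{ in } \mathcal G(A)\},$$ $$T_i=\{l\ge\mu_i : \text{some } j\ge l \text{ has access to } S_i \text{ in } \mathcal G(A)\}.$$ Let $(J,K)$ be any partition of $\langle m\rangle$ into two disjoint, possibly empty, sets. Let $\Psi$ be the finest order preserving partition of $\langle n\rangle$ encompassing the $F_i$, $i\in J$, and $\Upsilon$ the finest order preserving partition of $\langle n\rangle$ encompassing the $T_i$, $i\in K$. Then there exist $n\times n$ M-matrices $L$ and $U$ with $A=LU$ such that the block lower triangular self-partition of $L$ is a refinement of $\Psi$ and the block upper triangular self-partition of $U$ is a refinement of $\Upsilon$. -/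

import Mathlib

namespace BlockLU

open Finset

/-- `X` is an M-matrix: `X = α I - P` with `P` entrywise nonnegative and `α ≥ ρ(P)`, where `ρ(P)`
is the spectral radius (computed over `ℂ`). As `ρ(P)` is a nonnegative extended real,
`α ≥ ρ(P)` is spelled out as `0 ≤ α` together with `ρ(P) ≤ α` in `[0, ∞]`. -/
def IsMMatrix {n : ℕ} (X : Matrix (Fin n) (Fin n) ℝ) : Prop :=
  ∃ (α : ℝ) (P : Matrix (Fin n) (Fin n) ℝ),
    X = α • (1 : Matrix (Fin n) (Fin n) ℝ) - P ∧ (∀ i j, 0 ≤ P i j) ∧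
      0 ≤ α ∧ spectralRadius ℂ (P.map Complex.ofReal) ≤ ENNReal.ofReal α

/-! ### The directed graph of a matrix -/

/-- The edge relation of the directed graph of `X`. -/
def Edge {n : ℕ} (X : Matrix (Fin n) (Fin n) ℝ) (i j : Fin n) : Prop := X i j ≠ 0

/-- `j` has access to `k` in the directed graph of `X`: there is a (possibly empty) path from `j`
to `k`. -/
def HasAccess {n : ℕ} (X : Matrix (Fin n) (Fin n) ℝ) (j k : Fin n) : Prop :=
  Relation.ReflTransGen (Edge X) j k

/-- `j` and `k` communicate in the directed graph of `X`. -/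
def Communicate {n : ℕ} (X : Matrix (Fin n) (Fin n) ℝ) (j k : Fin n) : Prop :=
  HasAccess X j k ∧ HasAccess X k j

/-- `S` is a class of `X`: an equivalence class of the communication relation. -/
def IsClass {n : ℕ} (X : Matrix (Fin n) (Fin n) ℝ) (S : Finset (Fin n)) : Prop :=
  ∃ v, ∀ w, w ∈ S ↔ Communicate X v w

/-- `S` is a singular class of `X`: a class whose principal submatrix is singular. -/
def IsSingularClass {n : ℕ} (X : Matrix (Fin n) (Fin n) ℝ) (S : Finset (Fin n)) : Prop :=
  IsClass X S ∧ (X.submatrix (fun i : S => (i : Fin n)) (fun j : S => (j : Fin n))).det = 0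

/-- `S 0, …, S (m - 1)` lists all the singular classes of `X`, in increasing order of their maximal
elements (in particular without repetition). -/
structure IsSingularClassList {n m : ℕ} (X : Matrix (Fin n) (Fin n) ℝ)
    (S : Fin m → Finset (Fin n)) : Prop where
  mem_iff : ∀ C : Finset (Fin n), IsSingularClass X C ↔ ∃ i, S i = C
  max_lt_max : ∀ i j, i < j → (S i).max < (S j).max

open Classical in
/-- `{l ≥ max S | there is j ≥ l that is accessed from S}`. -/
noncomputable def accessedFrom {n : ℕ} (X : Matrix (Fin n) (Fin n) ℝ) (S : Finset (Fin n)) :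
    Finset (Fin n) :=
  {l | S.max ≤ (l : WithBot (Fin n)) ∧ ∃ j, l ≤ j ∧ ∃ s ∈ S, HasAccess X s j}

open Classical in
/-- `{l ≥ max S | there is j ≥ l that has access to S}`. -/
noncomputable def accessTo {n : ℕ} (X : Matrix (Fin n) (Fin n) ℝ) (S : Finset (Fin n)) :
    Finset (Fin n) :=
  {l | S.max ≤ (l : WithBot (Fin n)) ∧ ∃ j, l ≤ j ∧ ∃ s ∈ S, HasAccess X j s}

/-! ### Order preserving partitions

Partitions of the index set are Mathlib's `Finpartition univ`, ordered by refinement: `P ≤ Q` if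
every part of `P` lies in a part of `Q`. The order of the blocks of an order preserving partition
is determined by the blocks. -/

/-- The parts of `P` can be numbered (`k i` is the number of the part containing `i`) in such a way
that `i < j` implies `k i ≤ k j`. -/
def IsOrderPreserving {n : ℕ} (P : Finpartition (univ : Finset (Fin n))) : Prop :=
  ∃ k : Fin n → ℕ, (∀ i j, P.part i = P.part j ↔ k i = k j) ∧ ∀ i j, i < j → k i ≤ k j

/-- `P` is a refinement of the order preserving partition `Q`. -/
def IsRefinement {n : ℕ} (P Q : Finpartition (univ : Finset (Fin n))) : Prop :=
  IsOrderPreserving P ∧ P ≤ Q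

/-- `X` is block lower triangular with respect to `P`: for every part `v`, the submatrix with rows
in `v` and columns in `{j | j > max v}` vanishes. -/
def IsBlockLower {n : ℕ} (X : Matrix (Fin n) (Fin n) ℝ)
    (P : Finpartition (univ : Finset (Fin n))) : Prop :=
  ∀ v ∈ P.parts, ∀ i ∈ v, ∀ j : Fin n, v.max < (j : WithBot (Fin n)) → X i j = 0

/-- `X` is block upper triangular with respect to `P`: for every part `v`, the submatrix with rows
in `{i | i > max v}` and columns in `v` vanishes. -/
def IsBlockUpper {n : ℕ} (X : Matrix (Fin n) (Fin n) ℝ)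
    (P : Finpartition (univ : Finset (Fin n))) : Prop :=
  ∀ v ∈ P.parts, ∀ i : Fin n, v.max < (i : WithBot (Fin n)) → ∀ j ∈ v, X i j = 0

/-- `P` encompasses the sets `F i`, `i ∈ J`: each of them lies in a part of `P`. -/
def Encompasses {n : ℕ} {ι : Type*} (P : Finpartition (univ : Finset (Fin n))) (J : Finset ι)
    (F : ι → Finset (Fin n)) : Prop :=
  ∀ i ∈ J, ∃ v ∈ P.parts, F i ⊆ v

open Classical in
/-- The greatest lower bound, with respect to refinement, of the order preserving partitions with
the property `p`. -/
noncomputable def glbPartition {n : ℕ} (p : Finpartition (univ : Finset (Fin n)) → Prop) :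
    Finpartition (univ : Finset (Fin n)) :=
  (univ.filter fun P => IsOrderPreserving P ∧ p P).inf id

/-- The block lower triangular self-partition of `X`. -/
noncomputable def lowerSelfPartition {n : ℕ} (X : Matrix (Fin n) (Fin n) ℝ) :
    Finpartition (univ : Finset (Fin n)) :=
  glbPartition (IsBlockLower X)

/-- The block upper triangular self-partition of `X`. -/
noncomputable def upperSelfPartition {n : ℕ} (X : Matrix (Fin n) (Fin n) ℝ) :
    Finpartition (univ : Finset (Fin n)) :=
  glbPartition (IsBlockUpper X)

/-- The finest order preserving partition encompassing the sets `F i`, `i ∈ J`. -/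
noncomputable def finestEncompassing {n : ℕ} {ι : Type*} (J : Finset ι)
    (F : ι → Finset (Fin n)) : Finpartition (univ : Finset (Fin n)) :=
  glbPartition fun P => Encompasses P J F

/-! ### The greatest lower bounds above have the properties that define them -/

theorem part_inf_eq_iff {n : ℕ} (P Q : Finpartition (univ : Finset (Fin n))) (i j : Fin n) :
    (P ⊓ Q).part i = (P ⊓ Q).part j ↔ P.part i = P.part j ∧ Q.part i = Q.part j := by
  have key : ∀ i, (P ⊓ Q).part i = P.part i ∩ Q.part i := by
    intro i
    refine Finpartition.part_eq_of_mem _ ?_ (by simp)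
    rw [Finpartition.parts_inf]
    refine mem_erase.2 ⟨?_, mem_image.2 ⟨(P.part i, Q.part i), ?_, rfl⟩⟩
    · exact Finset.Nonempty.ne_empty ⟨i, by simp⟩
    · simp [Finpartition.part_mem]
  have e : ∀ R : Finpartition (univ : Finset (Fin n)), R.part i = R.part j ↔ i ∈ R.part j :=
    fun R => (R.mem_part_iff_part_eq_part (mem_univ _) (mem_univ _)).symm
  rw [e, e, e, key, mem_inter]

theorem part_top_eq {n : ℕ} (i j : Fin n) :
    (⊤ : Finpartition (univ : Finset (Fin n))).part i =
      (⊤ : Finpartition (univ : Finset (Fin n))).part j :=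
  Finpartition.parts_top_subsingleton _ ((Finpartition.part_mem _).2 (mem_univ i))
    ((Finpartition.part_mem _).2 (mem_univ j))

theorem part_glbPartition_eq_iff {n : ℕ} (p : Finpartition (univ : Finset (Fin n)) → Prop)
    (i j : Fin n) : (glbPartition p).part i = (glbPartition p).part j ↔
      ∀ P, IsOrderPreserving P → p P → P.part i = P.part j := by
  classical
  have h : ∀ s : Finset (Finpartition (univ : Finset (Fin n))),
      (s.inf id).part i = (s.inf id).part j ↔ ∀ P ∈ s, P.part i = P.part j := by
    intro s
    induction s using Finset.induction_on with
    | empty => simpa using part_top_eq i j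
    | insert a s _ ih => simp [Finset.inf_insert, part_inf_eq_iff, ih]
  unfold glbPartition
  rw [h]
  simp

theorem isOrderPreserving_inf {n : ℕ} {P Q : Finpartition (univ : Finset (Fin n))}
    (hP : IsOrderPreserving P) (hQ : IsOrderPreserving Q) : IsOrderPreserving (P ⊓ Q) := by
  obtain ⟨k, hk, hk'⟩ := hP
  obtain ⟨l, hl, hl'⟩ := hQ
  refine ⟨fun i => k i + l i, fun i j => ?_, fun i j hij => add_le_add (hk' i j hij) (hl' i j hij)⟩
  rw [part_inf_eq_iff, hk, hl]
  show _ ↔ k i + l i = k j + l j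
  rcases lt_trichotomy i j with h | h | h
  · have := hk' i j h
    have := hl' i j h
    omega
  · simp [h]
  · have := hk' j i h
    have := hl' j i h
    omega

theorem isOrderPreserving_glbPartition {n : ℕ}
    (p : Finpartition (univ : Finset (Fin n)) → Prop) : IsOrderPreserving (glbPartition p) := by
  classical
  unfold glbPartition
  refine Finset.inf_induction (p := IsOrderPreserving) ?_ (fun a ha b hb => isOrderPreserving_inf ha hb)
    fun P hP => (mem_filter.1 hP).2.1
  exact ⟨fun _ => 0, fun i j => by simpa using part_top_eq i j, fun _ _ _ => le_rfl⟩

theorem glbPartition_le {n : ℕ} {p : Finpartition (univ : Finset (Fin n)) → Prop}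
    {P : Finpartition (univ : Finset (Fin n))} (hP : IsOrderPreserving P) (h : p P) :
    glbPartition p ≤ P := by
  classical
  unfold glbPartition
  exact Finset.inf_le (f := id) (mem_filter.2 ⟨mem_univ _, hP, h⟩)

theorem le_glbPartition {n : ℕ} {p : Finpartition (univ : Finset (Fin n)) → Prop}
    {Q : Finpartition (univ : Finset (Fin n))} (h : ∀ P, IsOrderPreserving P → p P → Q ≤ P) :
    Q ≤ glbPartition p := by
  classical
  unfold glbPartition
  exact Finset.le_inf fun P hP => h P (mem_filter.1 hP).2.1 (mem_filter.1 hP).2.2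

/-- For an order preserving partition, `j` exceeds the maximum of the part of `i` exactly if
`i < j` and `j` lies in another part. -/
theorem max_part_lt_iff {n : ℕ} {P : Finpartition (univ : Finset (Fin n))}
    (hP : IsOrderPreserving P) (i j : Fin n) :
    (P.part i).max < (j : WithBot (Fin n)) ↔ i < j ∧ P.part i ≠ P.part j := by
  have e : ∀ i j, P.part i = P.part j ↔ i ∈ P.part j :=
    fun i j => (P.mem_part_iff_part_eq_part (mem_univ _) (mem_univ _)).symm
  have hi : i ∈ P.part i := P.mem_part (mem_univ i)
  constructor
  · intro h
    refine ⟨WithBot.coe_lt_coe.1 (lt_of_le_of_lt (Finset.le_max hi) h), fun hij => ?_⟩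
    exact absurd (Finset.le_max ((e j i).1 hij.symm)) (not_le.2 h)
  · rintro ⟨hij, hne⟩
    obtain ⟨k, hk, hk'⟩ := hP
    obtain ⟨b, hb⟩ := Finset.max_of_mem hi
    rw [hb]
    refine WithBot.coe_lt_coe.2 (lt_of_not_ge fun hjb => hne ?_)
    have hbi : k b = k i := (hk b i).1 ((e b i).2 (Finset.mem_of_max hb))
    have h1 := hk' i j hij
    rcases hjb.lt_or_eq with h | h
    · have h2 := hk' j b h
      exact (hk i j).2 (by omega)
    · exact (hk i j).2 (by rw [h, hbi])

theorem isBlockLower_iff {n : ℕ} {X : Matrix (Fin n) (Fin n) ℝ}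
    {P : Finpartition (univ : Finset (Fin n))} (hP : IsOrderPreserving P) :
    IsBlockLower X P ↔ ∀ i j, i < j → P.part i ≠ P.part j → X i j = 0 := by
  constructor
  · intro h i j hij hne
    exact h _ ((Finpartition.part_mem _).2 (mem_univ i)) i (P.mem_part (mem_univ i)) j
      ((max_part_lt_iff hP i j).2 ⟨hij, hne⟩)
  · intro h v hv i hi j hj
    rw [← P.part_eq_of_mem hv hi, max_part_lt_iff hP] at hj
    exact h i j hj.1 hj.2

theorem isBlockUpper_iff {n : ℕ} {X : Matrix (Fin n) (Fin n) ℝ}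
    {P : Finpartition (univ : Finset (Fin n))} (hP : IsOrderPreserving P) :
    IsBlockUpper X P ↔ ∀ i j, j < i → P.part j ≠ P.part i → X i j = 0 := by
  constructor
  · intro h i j hij hne
    exact h _ ((Finpartition.part_mem _).2 (mem_univ j)) i ((max_part_lt_iff hP j i).2 ⟨hij, hne⟩)
      j (P.mem_part (mem_univ j))
  · intro h v hv i hi j hj
    rw [← P.part_eq_of_mem hv hj, max_part_lt_iff hP] at hi
    exact h i j hi.1 hi.2

theorem isBlockLower_lowerSelfPartition {n : ℕ} (X : Matrix (Fin n) (Fin n) ℝ) :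
    IsBlockLower X (lowerSelfPartition X) := by
  refine (isBlockLower_iff (isOrderPreserving_glbPartition _)).2 fun i j hij hne => ?_
  rw [Ne, part_glbPartition_eq_iff] at hne
  push Not at hne
  obtain ⟨P, hP, hX, h⟩ := hne
  exact (isBlockLower_iff hP).1 hX i j hij h

theorem isBlockUpper_upperSelfPartition {n : ℕ} (X : Matrix (Fin n) (Fin n) ℝ) :
    IsBlockUpper X (upperSelfPartition X) := by
  refine (isBlockUpper_iff (isOrderPreserving_glbPartition _)).2 fun i j hij hne => ?_
  rw [Ne, part_glbPartition_eq_iff] at hne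
  push Not at hne
  obtain ⟨P, hP, hX, h⟩ := hne
  exact (isBlockUpper_iff hP).1 hX i j hij h

/-- The encompassed sets are required to be nonempty because on an empty index set there is no part
at all; the sets that matter here are nonempty. -/
theorem encompasses_finestEncompassing {n : ℕ} {ι : Type*} (J : Finset ι)
    (F : ι → Finset (Fin n)) (hF : ∀ i ∈ J, (F i).Nonempty) :
    Encompasses (finestEncompassing J F) J F := by
  intro i hi
  obtain ⟨a, ha⟩ := hF i hi
  refine ⟨_, (Finpartition.part_mem _).2 (mem_univ a), fun b hb => ?_⟩
  rw [Finpartition.mem_part_iff_part_eq_part _ (mem_univ _) (mem_univ _), finestEncompassing,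
    part_glbPartition_eq_iff]
  intro P _ hP
  obtain ⟨v, hv, hFv⟩ := hP i hi
  rw [P.part_eq_of_mem hv (hFv ha), P.part_eq_of_mem hv (hFv hb)]

/-- Every matrix has a list of its singular classes of the kind required above. -/
theorem exists_isSingularClassList {n : ℕ} (X : Matrix (Fin n) (Fin n) ℝ) :
    ∃ (m : ℕ) (S : Fin m → Finset (Fin n)), IsSingularClassList X S := by
  classical
  have hne : ∀ C, IsSingularClass X C → C.max ≠ ⊥ := by
    rintro C ⟨⟨v, hv⟩, -⟩ h
    rw [Finset.max_eq_bot] at h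
    have : v ∈ C := (hv v).2 ⟨Relation.ReflTransGen.refl, Relation.ReflTransGen.refl⟩
    simp [h] at this
  have hinj : ∀ C D, IsSingularClass X C → IsSingularClass X D → C.max = D.max → C = D := by
    intro C D hC hD h
    obtain ⟨a, ha⟩ := WithBot.ne_bot_iff_exists.1 (hne C hC)
    have haC := Finset.mem_of_max ha.symm
    have haD := Finset.mem_of_max (h ▸ ha.symm)
    obtain ⟨⟨v, hv⟩, -⟩ := hC
    obtain ⟨⟨w, hw⟩, -⟩ := hD
    have h1 := (hv a).1 haC
    have h2 := (hw a).1 haD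
    ext x
    rw [hv, hw]
    constructor
    · intro hx
      exact ⟨h2.1.trans (h1.2.trans hx.1), hx.2.trans (h1.1.trans h2.2)⟩
    · intro hx
      exact ⟨h1.1.trans (h2.2.trans hx.1), hx.2.trans (h2.1.trans h1.2)⟩
  let M : Finset (WithBot (Fin n)) := (univ.filter (IsSingularClass X)).image Finset.max
  have hM : ∀ i : Fin M.card, ∃ C, IsSingularClass X C ∧ C.max = M.orderEmbOfFin rfl i := by
    intro i
    have := M.orderEmbOfFin_mem rfl i
    obtain ⟨C, hC, h⟩ := mem_image.1 this
    exact ⟨C, (mem_filter.1 hC).2, h⟩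
  choose S hS hSmax using hM
  refine ⟨M.card, S, fun C => ⟨fun hC => ?_, ?_⟩, fun i j hij => ?_⟩
  · have : C.max ∈ Set.range (M.orderEmbOfFin rfl) := by
      rw [M.range_orderEmbOfFin rfl]
      exact mem_image.2 ⟨C, mem_filter.2 ⟨mem_univ _, hC⟩, rfl⟩
    obtain ⟨i, hi⟩ := this
    exact ⟨i, hinj _ _ (hS i) hC ((hSmax i).trans hi)⟩
  · rintro ⟨i, rfl⟩
    exact hS i
  · rw [hSmax, hSmax]
    exact (M.orderEmbOfFin rfl).strictMono hij

end BlockLU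

/-!
# Block LU factorization of M-matrices

The factors are produced by Gaussian elimination of the indices in increasing order, by induction
on `n` (`IsMMatrix.hasFactorization`). Let `A = [a, r; c, B]` with leading entry `a`.

If `a > 0`, the Schur complement `B - c r / a` is again an M-matrix. Access between the remaining
indices is the same in it as in `A`, and the maxima of its singular classes are maxima of singular
classes of `A`. A factorization `L' U'` of the complement extends to `L = [1, 0; c / a, L']` and
`U = [a, r; 0, U']`.

If `a = 0`, the index `0` lies on no cycle of the graph, so it is a singular class by itself. After
transposition it belongs to `J`, so that `L` may be full on the indices between `0` and the largest
index accessed from `0`. Factor `B = L' U'` and put `U = [1, 0; 0, U']` and `L = [0, -x; c, L']`,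
where `x` has to solve `x U' = -r`. The row `r` lives on the indices accessed from `0`. All
singular classes among them can be moved to `J` before `B` is factored, as their sets `F` are
contained in the one of the class `{0}`. Then `U'` is regular on these indices and a nonnegative
solution `x`, supported there, exists.

The induction carries this solvability along, together with the facts that the nonzero entries of
the factors are accesses in `A` and that each nonzero entry on the wrong side of the diagonal is
covered by sets `F` (or `T`). All of this is collected in `IsRightFactor`; the left factor is
described by the same structure through transposition.

That the matrices constructed are M-matrices is checked with `isMMatrix_iff`: `X` is an M-matrix
iff its off-diagonal entries are nonpositive and for every `ε > 0` some positive vector `x`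
satisfies `X x + ε x ≥ 0`.
-/

namespace BlockLU

open Finset Filter Topology
open scoped ENNReal Matrix

/-! ### M-matrices and positive vectors -/

section Spectral

attribute [local instance] Matrix.linftyOpNormedRing Matrix.linftyOpNormedAlgebra

/-- Gelfand's formula bounds the row sums of some positive power of a nonnegative matrix. -/
theorem exists_pow_mulVec_one_le {n : ℕ} {P : Matrix (Fin n) (Fin n) ℝ} {t : ℝ} (ht : 0 < t)
    (h : spectralRadius ℂ (P.map Complex.ofReal) < ENNReal.ofReal t) :
    ∃ k : ℕ, 0 < k ∧ ∀ i, ((P ^ k) *ᵥ 1) i ≤ t ^ k := by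
  have hlim := spectrum.pow_nnnorm_pow_one_div_tendsto_nhds_spectralRadius (P.map Complex.ofReal)
  obtain ⟨k, hk, hk0⟩ := ((hlim.eventually_lt_const h).and (eventually_gt_atTop 0)).exists
  refine ⟨k, hk0, fun i => ?_⟩
  have hk' : (k : ℝ) ≠ 0 := by positivity
  have h1 : (‖(P.map Complex.ofReal) ^ k‖₊ : ℝ≥0∞) ≤ ENNReal.ofReal (t ^ k) := by
    have := ENNReal.rpow_le_rpow hk.le (Nat.cast_nonneg (α := ℝ) k)
    rwa [← ENNReal.rpow_mul, one_div, inv_mul_cancel₀ hk', ENNReal.rpow_one,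
      ENNReal.rpow_natCast, ← ENNReal.ofReal_pow ht.le] at this
  have h2 : ‖(P.map Complex.ofReal) ^ k‖ ≤ t ^ k := by
    rwa [← enorm_eq_nnnorm, ← ofReal_norm,
      ENNReal.ofReal_le_ofReal_iff (by positivity)] at h1
  have h3 : (P.map Complex.ofReal) ^ k = (P ^ k).map Complex.ofReal :=
    (map_pow (Complex.ofRealHom.mapMatrix (m := Fin n)) P k).symm
  have h4 : (((P ^ k).map Complex.ofReal) *ᵥ 1) i = (((P ^ k) *ᵥ 1) i : ℝ) := by
    simp [Matrix.mulVec, dotProduct]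
  rw [h3] at h2
  have hone : ‖(1 : Fin n → ℂ)‖ ≤ 1 := (pi_norm_le_iff_of_nonneg zero_le_one).2 fun _ => by simp
  calc ((P ^ k) *ᵥ 1) i ≤ ‖(((P ^ k).map Complex.ofReal) *ᵥ 1) i‖ := by
        rw [h4, Complex.norm_real]; exact le_abs_self _
    _ ≤ ‖((P ^ k).map Complex.ofReal) *ᵥ 1‖ := norm_le_pi_norm _ i
    _ ≤ ‖(P ^ k).map Complex.ofReal‖ * ‖(1 : Fin n → ℂ)‖ := Matrix.linfty_opNorm_mulVec _ _
    _ ≤ ‖(P ^ k).map Complex.ofReal‖ * 1 := by gcongr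
    _ ≤ t ^ k := by rwa [mul_one]

end Spectral

/-- The finite Neumann sum of a vector that the nonnegative matrix `P` does not blow up is a
positive vector `x` with `P x ≤ t x`. -/
theorem exists_pos_mulVec_le {n : ℕ} {P : Matrix (Fin n) (Fin n) ℝ} (hP : ∀ i j, 0 ≤ P i j)
    {t : ℝ} (ht : 0 < t) (h : spectralRadius ℂ (P.map Complex.ofReal) < ENNReal.ofReal t) :
    ∃ x : Fin n → ℝ, (∀ i, 0 < x i) ∧ ∀ i, (P *ᵥ x) i ≤ t * x i := by
  obtain ⟨k, hk, hle⟩ := exists_pow_mulVec_one_le ht h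
  have hnn : ∀ (l : ℕ) i, 0 ≤ ((P ^ l) *ᵥ 1) i := by
    intro l
    induction l with
    | zero => simp
    | succ l ih =>
      intro i
      rw [pow_succ', ← Matrix.mulVec_mulVec]
      exact dotProduct_nonneg_of_nonneg (fun j => hP i j) ih
  let x : Fin n → ℝ := ∑ l ∈ range k, (t ^ l)⁻¹ • ((P ^ l) *ᵥ 1)
  have hx : ∀ i, x i = ∑ l ∈ range k, (t ^ l)⁻¹ * ((P ^ l) *ᵥ 1) i := fun i => by
    simp [x, Finset.sum_apply]
  have hPx : ∀ i, (P *ᵥ x) i = ∑ l ∈ range k, (t ^ l)⁻¹ * ((P ^ (l + 1)) *ᵥ 1) i := fun i => by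
    simp [x, Matrix.mulVec_sum, Finset.sum_apply, Matrix.mulVec_smul, Matrix.mulVec_mulVec,
      ← pow_succ']
  refine ⟨x, fun i => ?_, fun i => ?_⟩
  · rw [hx]
    refine Finset.sum_pos' (fun l _ => mul_nonneg (by positivity) (hnn l i))
      ⟨0, mem_range.2 hk, by simp⟩
  · have e : t * x i - (P *ᵥ x) i = t * (1 - (t ^ k)⁻¹ * ((P ^ k) *ᵥ 1) i) := by
      have hs := Finset.sum_range_sub' (fun l => (t ^ l)⁻¹ * ((P ^ l) *ᵥ 1) i) k
      simp only [pow_zero, inv_one, one_mul, Matrix.one_mulVec, Pi.one_apply] at hs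
      rw [← hs, hx, hPx, Finset.mul_sum, Finset.mul_sum, ← Finset.sum_sub_distrib]
      refine Finset.sum_congr rfl fun l _ => ?_
      rw [pow_succ t l]
      field_simp
    have h1 : (t ^ k)⁻¹ * ((P ^ k) *ᵥ 1) i ≤ 1 := by
      rw [inv_mul_le_iff₀ (by positivity), mul_one]
      exact hle i
    nlinarith

/-- A positive vector `x` with `P x ≤ t x` bounds the eigenvalues of the nonnegative matrix `P`: it
serves as the weight of a maximum norm. -/
theorem norm_le_of_mem_spectrum {n : ℕ} {P : Matrix (Fin n) (Fin n) ℝ} (hP : ∀ i j, 0 ≤ P i j)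
    {t : ℝ} {x : Fin n → ℝ} (hx : ∀ i, 0 < x i) (hPx : ∀ i, (P *ᵥ x) i ≤ t * x i) {z : ℂ}
    (hz : z ∈ spectrum ℂ (P.map Complex.ofReal)) : ‖z‖ ≤ t := by
  rw [spectrum.mem_iff, Matrix.isUnit_iff_isUnit_det, isUnit_iff_ne_zero, not_not] at hz
  obtain ⟨v, hv, hPv⟩ := Matrix.exists_mulVec_eq_zero_iff.2 hz
  have hev : ∀ i, z * v i = ∑ j, (P i j : ℂ) * v j := by
    intro i
    have := congrFun hPv i
    rw [Algebra.algebraMap_eq_smul_one, Matrix.sub_mulVec, Matrix.smul_mulVec,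
      Matrix.one_mulVec, Pi.sub_apply, Pi.zero_apply, sub_eq_zero] at this
    simpa [Matrix.mulVec, dotProduct] using this
  obtain ⟨i₀, hi₀⟩ := Function.ne_iff.1 hv
  obtain ⟨i, -, hi⟩ := Finset.exists_max_image univ (fun i => ‖v i‖ / x i) ⟨i₀, mem_univ _⟩
  have hvi : 0 < ‖v i‖ := by
    have : 0 < ‖v i‖ / x i :=
      lt_of_lt_of_le (div_pos (norm_pos_iff.2 hi₀) (hx i₀)) (hi i₀ (mem_univ _))
    exact (div_pos_iff_of_pos_right (hx i)).1 this
  have hbd : ∀ j, ‖v j‖ ≤ ‖v i‖ / x i * x j := fun j => by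
    have := hi j (mem_univ _)
    rwa [div_le_iff₀ (hx j)] at this
  have : ‖z‖ * ‖v i‖ ≤ t * ‖v i‖ := by
    calc ‖z‖ * ‖v i‖ = ‖∑ j, (P i j : ℂ) * v j‖ := by rw [← norm_mul, hev]
      _ ≤ ∑ j, ‖(P i j : ℂ) * v j‖ := norm_sum_le _ _
      _ ≤ ∑ j, P i j * (‖v i‖ / x i * x j) := by
        refine Finset.sum_le_sum fun j _ => ?_
        rw [norm_mul, Complex.norm_real, Real.norm_of_nonneg (hP i j)]
        exact mul_le_mul_of_nonneg_left (hbd j) (hP i j)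
      _ = ‖v i‖ / x i * (P *ᵥ x) i := by
        simp only [Matrix.mulVec, dotProduct, Finset.mul_sum]
        exact Finset.sum_congr rfl fun j _ => by ring
      _ ≤ ‖v i‖ / x i * (t * x i) := by
        exact mul_le_mul_of_nonneg_left (hPx i) (div_nonneg hvi.le (hx i).le)
      _ = t * ‖v i‖ := by field_simp [(hx i).ne']
  exact le_of_mul_le_mul_right this hvi

/-- A matrix is an M-matrix iff its off-diagonal entries are nonpositive and every shift
`X + ε I`, `ε > 0`, is nonnegative on some positive vector. -/
theorem isMMatrix_iff {n : ℕ} {X : Matrix (Fin n) (Fin n) ℝ} :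
    IsMMatrix X ↔ (∀ i j, i ≠ j → X i j ≤ 0) ∧
      ∀ ε : ℝ, 0 < ε → ∃ x : Fin n → ℝ, (∀ i, 0 < x i) ∧ ∀ i, 0 ≤ (X *ᵥ x) i + ε * x i := by
  constructor
  · rintro ⟨α, P, rfl, hP, hα, hρ⟩
    refine ⟨fun i j hij => by simp [hij, hP i j], fun ε hε => ?_⟩
    obtain ⟨x, hx, hPx⟩ := exists_pos_mulVec_le hP (t := α + ε) (by positivity)
      (hρ.trans_lt ((ENNReal.ofReal_lt_ofReal_iff (by positivity)).2 (by linarith)))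
    refine ⟨x, hx, fun i => ?_⟩
    have := hPx i
    simp only [Matrix.sub_mulVec, Matrix.smul_mulVec, Matrix.one_mulVec, Pi.sub_apply,
      Pi.smul_apply, smul_eq_mul]
    linarith
  · rintro ⟨hZ, hpos⟩
    let α : ℝ := ∑ i, |X i i|
    have hα : 0 ≤ α := Finset.sum_nonneg fun _ _ => abs_nonneg _
    have hle : ∀ i, X i i ≤ α := fun i => (le_abs_self _).trans
      (Finset.single_le_sum (f := fun i => |X i i|) (fun _ _ => abs_nonneg _) (mem_univ i))
    have hP : ∀ i j, 0 ≤ (α • (1 : Matrix (Fin n) (Fin n) ℝ) - X) i j := by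
      intro i j
      by_cases hij : i = j
      · subst hij
        simpa using hle i
      · simpa [hij] using hZ i j hij
    refine ⟨α, α • 1 - X, by simp, hP, hα, iSup₂_le fun z hz => ?_⟩
    rw [← enorm_eq_nnnorm, ← ofReal_norm]
    refine ENNReal.ofReal_le_ofReal (le_of_forall_pos_le_add fun ε hε => ?_)
    obtain ⟨x, hx, hXx⟩ := hpos ε hε
    refine norm_le_of_mem_spectrum hP hx (fun i => ?_) hz
    have := hXx i
    simp only [Matrix.sub_mulVec, Matrix.smul_mulVec, Matrix.one_mulVec, Pi.sub_apply,
      Pi.smul_apply, smul_eq_mul]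
    linarith

theorem IsMMatrix.transpose {n : ℕ} {X : Matrix (Fin n) (Fin n) ℝ} (h : IsMMatrix X) :
    IsMMatrix Xᵀ := by
  obtain ⟨α, P, rfl, hP, hα, hρ⟩ := h
  refine ⟨α, Pᵀ, by simp, fun i j => hP j i, hα, ?_⟩
  have : spectrum ℂ (Pᵀ.map Complex.ofReal) = spectrum ℂ (P.map Complex.ofReal) := by
    ext z
    rw [spectrum.mem_iff, spectrum.mem_iff, Matrix.transpose_map,
      ← Matrix.isUnit_transpose (A := algebraMap ℂ _ z - P.map Complex.ofReal)]
    simp [Algebra.algebraMap_eq_smul_one]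
  simpa only [spectralRadius, this] using hρ

theorem exists_pos_forall_mul_le {ι : Type*} [Finite ι] (a b : ι → ℝ) (hb : ∀ i, 0 < b i) :
    ∃ t : ℝ, 0 < t ∧ t ≤ 1 ∧ ∀ i, a i * t ≤ b i := by
  have h : ∀ i, ∀ᶠ t in 𝓝[>] (0 : ℝ), a i * t ≤ b i := fun i => by
    have : Tendsto (fun t : ℝ => a i * t) (𝓝[>] 0) (𝓝 (a i * 0)) :=
      ((continuous_const.mul continuous_id).tendsto 0).mono_left nhdsWithin_le_nhds
    rw [mul_zero] at this
    exact (this.eventually_lt_const (hb i)).mono fun _ => le_of_lt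
  obtain ⟨t, ⟨ht, ht0⟩, ht1⟩ := (((eventually_all.2 h).and self_mem_nhdsWithin).and
    (Ioc_mem_nhdsGT (zero_lt_one' ℝ))).exists
  exact ⟨t, ht0, ht1.2, ht⟩

theorem mulVec_le_diag {n : ℕ} {X : Matrix (Fin n) (Fin n) ℝ} (hX : ∀ i j, i ≠ j → X i j ≤ 0)
    {x : Fin n → ℝ} (hx : ∀ i, 0 < x i) (i : Fin n) : (X *ᵥ x) i ≤ X i i * x i := by
  simp only [Matrix.mulVec, dotProduct]
  rw [← Finset.add_sum_erase _ _ (mem_univ i)]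
  have : ∑ j ∈ univ.erase i, X i j * x j ≤ 0 := Finset.sum_nonpos fun j hj =>
    mul_nonpos_of_nonpos_of_nonneg (hX i j (Finset.ne_of_mem_erase hj).symm) (hx j).le
  linarith

theorem mulVec_le_diag_add {n : ℕ} {X : Matrix (Fin n) (Fin n) ℝ}
    (hX : ∀ i j, i ≠ j → X i j ≤ 0) {x : Fin n → ℝ} (hx : ∀ i, 0 < x i) {i j : Fin n}
    (hij : i ≠ j) : (X *ᵥ x) i ≤ X i i * x i + X i j * x j := by
  simp only [Matrix.mulVec, dotProduct]
  rw [← Finset.add_sum_erase _ _ (mem_univ i),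
    ← Finset.add_sum_erase _ _ (mem_erase.2 ⟨hij.symm, mem_univ j⟩)]
  have : ∑ l ∈ (univ.erase i).erase j, X i l * x l ≤ 0 := Finset.sum_nonpos fun l hl =>
    mul_nonpos_of_nonpos_of_nonneg
      (hX i l (Finset.ne_of_mem_erase (Finset.mem_of_mem_erase hl)).symm) (hx l).le
  linarith

theorem IsMMatrix.diag_nonneg {n : ℕ} {X : Matrix (Fin n) (Fin n) ℝ} (h : IsMMatrix X)
    (i : Fin n) : 0 ≤ X i i := by
  obtain ⟨hZ, hpos⟩ := isMMatrix_iff.1 h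
  refine le_of_forall_pos_le_add fun ε hε => ?_
  obtain ⟨x, hx, hXx⟩ := hpos ε hε
  have h1 := mulVec_le_diag hZ hx i
  have h2 := hXx i
  have h3 : 0 ≤ (X i i + ε) * x i := by linarith
  exact nonneg_of_mul_nonneg_left h3 (hx i)

/-- Along a path from `i` to `j`, the positive vectors that certify the M-matrix property can grow
at most by a factor that does not depend on the shift. -/
theorem exists_bound_of_hasAccess {n : ℕ} {X : Matrix (Fin n) (Fin n) ℝ}
    (hZ : ∀ i j, i ≠ j → X i j ≤ 0) {i j : Fin n} (h : HasAccess X i j) :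
    ∃ C : ℝ, 0 < C ∧ ∀ (ε : ℝ) (x : Fin n → ℝ), ε ≤ 1 → (∀ i, 0 < x i) →
      (∀ i, 0 ≤ (X *ᵥ x) i + ε * x i) → x j ≤ C * x i := by
  induction h with
  | refl => exact ⟨1, one_pos, fun ε x _ _ _ => by simp⟩
  | @tail b c _ hbc ih =>
    obtain ⟨C, hC, hCx⟩ := ih
    by_cases hne : b = c
    · exact hne ▸ ⟨C, hC, hCx⟩
    have hneg : 0 < -X b c := neg_pos.2 (lt_of_le_of_ne (hZ b c hne) hbc)
    refine ⟨(|X b b| + 1) / (-X b c) * C, by positivity, fun ε x hε hx hXx => ?_⟩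
    have h1 := mulVec_le_diag_add hZ hx hne
    have h2 := hXx b
    have h3 : -X b c * x c ≤ (|X b b| + 1) * x b := by
      have := mul_le_mul_of_nonneg_right (le_abs_self (X b b)) (hx b).le
      have := mul_le_mul_of_nonneg_right hε (hx b).le
      linarith
    calc x c ≤ (|X b b| + 1) / (-X b c) * x b := by
          rw [div_mul_eq_mul_div, le_div_iff₀ hneg]
          linarith
      _ ≤ (|X b b| + 1) / (-X b c) * (C * x i) := by
          exact mul_le_mul_of_nonneg_left (hCx ε x hε hx hXx) (by positivity)
      _ = _ := by ring

/-- A vertex of an M-matrix with a zero on the diagonal lies on no cycle. -/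
theorem IsMMatrix.not_hasAccess_of_diag_eq_zero {n : ℕ} {X : Matrix (Fin n) (Fin n) ℝ}
    (h : IsMMatrix X) {i j : Fin n} (hi : X i i = 0) (hij : X i j ≠ 0) : ¬ HasAccess X j i := by
  intro hji
  obtain ⟨hZ, hpos⟩ := isMMatrix_iff.1 h
  have hne : i ≠ j := fun e => hij (e ▸ hi)
  obtain ⟨C, hC, hCx⟩ := exists_bound_of_hasAccess hZ hji
  have hneg : 0 < -X i j := neg_pos.2 (lt_of_le_of_ne (hZ i j hne) hij)
  obtain ⟨ε, hε, hε1, hεC⟩ := exists_pos_forall_mul_le (fun _ : Unit => C) (fun _ => -X i j / 2)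
    fun _ => by positivity
  obtain ⟨x, hx, hXx⟩ := hpos ε hε
  have h1 := mulVec_le_diag_add hZ hx hne
  have h2 := hXx i
  have h3 := mul_le_mul_of_nonneg_left (hCx ε x hε1 hx hXx) hε.le
  have h4 := mul_le_mul_of_nonneg_right (hεC ()) (hx j).le
  have h5 := mul_pos hneg (hx j)
  rw [hi] at h1
  nlinarith

/-! ### Bordered M-matrices and Schur complements -/

/-- The matrix `[p, q; c, X]`. -/
def border {n : ℕ} (p : ℝ) (q c : Fin n → ℝ) (X : Matrix (Fin n) (Fin n) ℝ) :
    Matrix (Fin (n + 1)) (Fin (n + 1)) ℝ :=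
  Matrix.of (Fin.cons (Fin.cons p q) fun i => Fin.cons (c i) (X i))

section border

variable {n : ℕ} (p : ℝ) (q c : Fin n → ℝ) (X : Matrix (Fin n) (Fin n) ℝ)

@[simp] theorem border_zero_zero : border p q c X 0 0 = p := rfl

@[simp] theorem border_zero_succ (j : Fin n) : border p q c X 0 j.succ = q j := rfl

@[simp] theorem border_succ_zero (i : Fin n) : border p q c X i.succ 0 = c i := rfl

@[simp] theorem border_succ_succ (i j : Fin n) : border p q c X i.succ j.succ = X i j := rfl

theorem border_transpose : (border p q c X)ᵀ = border p c q Xᵀ := by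
  ext i j
  refine Fin.cases ?_ (fun i => ?_) i <;> refine Fin.cases ?_ (fun j => ?_) j <;> rfl

end border

/-- A bordered M-matrix is an M-matrix if the new index lies on no cycle; `R` is a set of
indices that contains every index accessed from the new one and none that has access to it. -/
theorem isMMatrix_border {n : ℕ} {p : ℝ} {q c : Fin n → ℝ} {X : Matrix (Fin n) (Fin n) ℝ}
    (hX : IsMMatrix X) (hp : 0 ≤ p) (hq : ∀ j, q j ≤ 0) (hc : ∀ i, c i ≤ 0) (R : Set (Fin n))
    (hqR : ∀ j, q j ≠ 0 → j ∈ R) (hXR : ∀ i j, i ∈ R → X i j ≠ 0 → j ∈ R)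
    (hcR : ∀ i ∈ R, c i = 0) : IsMMatrix (border p q c X) := by
  classical
  obtain ⟨hZ, hpos⟩ := isMMatrix_iff.1 hX
  refine isMMatrix_iff.2 ⟨fun i j => ?_, fun ε hε => ?_⟩
  · refine Fin.cases ?_ (fun i => ?_) i <;> refine Fin.cases ?_ (fun j => ?_) j
    · exact fun h => absurd rfl h
    · exact fun _ => hq j
    · exact fun _ => hc i
    · exact fun h => hZ i j fun e => h (e ▸ rfl)
  obtain ⟨x, hx, hXx⟩ := hpos (ε / 2) (by positivity)
  -- The new entry `t` has to be small because of the column `c`, and then the entries on `R` have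
  -- to be scaled down by `s` because of the row `q`.
  obtain ⟨t, ht, -, htx⟩ := exists_pos_forall_mul_le (fun i => -c i) (fun i => ε / 2 * x i)
    fun i => mul_pos (by positivity) (hx i)
  obtain ⟨s, hs, hs1, hsq⟩ := exists_pos_forall_mul_le (fun _ : Unit => -∑ j, q j * x j)
    (fun _ => ε * t) fun _ => by positivity
  let y : Fin n → ℝ := fun j => if j ∈ R then s * x j else x j
  have hyR : ∀ j ∈ R, y j = s * x j := fun j hj => if_pos hj
  have hyR' : ∀ j, j ∉ R → y j = x j := fun j hj => if_neg hj
  have hyx : ∀ j, y j ≤ x j := fun j => by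
    by_cases hj : j ∈ R
    · rw [hyR j hj]
      nlinarith [hx j]
    · exact (hyR' j hj).le
  refine ⟨Fin.cons t y, fun i => ?_, fun i => ?_⟩
  · refine Fin.cases ht (fun i => ?_) i
    by_cases hi : i ∈ R
    · simpa [hyR i hi] using mul_pos hs (hx i)
    · simpa [hyR' i hi] using hx i
  · refine Fin.cases ?_ (fun i => ?_) i
    · have e : ∑ j, q j * y j = s * ∑ j, q j * x j := by
        rw [Finset.mul_sum]
        refine Finset.sum_congr rfl fun j _ => ?_
        by_cases hj : q j = 0
        · simp [hj]
        · rw [hyR j (hqR j hj)]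
          ring
      simp only [Matrix.mulVec, dotProduct, Fin.sum_univ_succ, border_zero_zero, Fin.cons_zero,
        border_zero_succ, Fin.cons_succ, e]
      have := hsq ()
      have := mul_nonneg hp ht.le
      linarith
    · simp only [Matrix.mulVec, dotProduct, Fin.sum_univ_succ, border_succ_zero, Fin.cons_zero,
        border_succ_succ, Fin.cons_succ]
      have h1 := hXx i
      simp only [Matrix.mulVec, dotProduct] at h1
      by_cases hi : i ∈ R
      · have e : ∑ j, X i j * y j = s * ∑ j, X i j * x j := by
          rw [Finset.mul_sum]
          refine Finset.sum_congr rfl fun j _ => ?_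
          by_cases hj : X i j = 0
          · simp [hj]
          · rw [hyR j (hXR i j hi hj)]
            ring
        rw [e, hcR i hi, hyR i hi]
        have h2 := mul_nonneg hs.le h1
        have h3 := mul_pos hε (mul_pos hs (hx i))
        linarith
      · have h2 : ∑ j, X i j * x j ≤ ∑ j, X i j * y j := by
          refine Finset.sum_le_sum fun j _ => ?_
          by_cases hij : i = j
          · rw [← hij, hyR' i hi]
          · exact mul_le_mul_of_nonpos_left (hyx j) (hZ i j hij)
        have h3 := htx i
        rw [hyR' i hi]
        linarith

theorem IsMMatrix.submatrix_succ {n : ℕ} {A : Matrix (Fin (n + 1)) (Fin (n + 1)) ℝ}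
    (hA : IsMMatrix A) : IsMMatrix (A.submatrix Fin.succ Fin.succ) := by
  obtain ⟨hZ, hpos⟩ := isMMatrix_iff.1 hA
  refine isMMatrix_iff.2
    ⟨fun i j hij => hZ _ _ fun e => hij (Fin.succ_injective _ e), fun ε hε => ?_⟩
  obtain ⟨x, hx, hAx⟩ := hpos ε hε
  refine ⟨fun i => x i.succ, fun i => hx _, fun i => ?_⟩
  have h1 := hAx i.succ
  simp only [Matrix.mulVec, dotProduct, Fin.sum_univ_succ (n := n)] at h1
  simp only [Matrix.mulVec, dotProduct, Matrix.submatrix_apply]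
  have := mul_nonpos_of_nonpos_of_nonneg (hZ i.succ 0 (Fin.succ_ne_zero i)) (hx 0).le
  linarith

/-- The Schur complement of the leading entry of `A`, meaningful if this entry is nonzero. -/
noncomputable def schur {n : ℕ} (A : Matrix (Fin (n + 1)) (Fin (n + 1)) ℝ) :
    Matrix (Fin n) (Fin n) ℝ :=
  Matrix.of fun i j => A i.succ j.succ - A i.succ 0 * A 0 j.succ / A 0 0

theorem schur_apply {n : ℕ} (A : Matrix (Fin (n + 1)) (Fin (n + 1)) ℝ) (i j : Fin n) :
    schur A i j = A i.succ j.succ - A i.succ 0 * A 0 j.succ / A 0 0 := rfl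

theorem schur_transpose {n : ℕ} (A : Matrix (Fin (n + 1)) (Fin (n + 1)) ℝ) :
    schur Aᵀ = (schur A)ᵀ := by
  ext i j
  simp [schur_apply, mul_comm]

theorem schur_mulVec {n : ℕ} (A : Matrix (Fin (n + 1)) (Fin (n + 1)) ℝ) (x : Fin n → ℝ)
    (i : Fin n) : (schur A *ᵥ x) i =
      ∑ j, A i.succ j.succ * x j - A i.succ 0 * (∑ j, A 0 j.succ * x j) / A 0 0 := by
  simp only [Matrix.mulVec, dotProduct, schur_apply, Finset.mul_sum, Finset.sum_div,
    ← Finset.sum_sub_distrib]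
  exact Finset.sum_congr rfl fun j _ => by ring

theorem IsMMatrix.schur {n : ℕ} {A : Matrix (Fin (n + 1)) (Fin (n + 1)) ℝ} (hA : IsMMatrix A)
    (h0 : 0 < A 0 0) : IsMMatrix (schur A) := by
  have hB := (isMMatrix_iff.1 hA.submatrix_succ).1
  obtain ⟨hZ, hpos⟩ := isMMatrix_iff.1 hA
  have hc : ∀ i : Fin n, A i.succ 0 ≤ 0 := fun i => hZ _ _ (Fin.succ_ne_zero i)
  have hr : ∀ j : Fin n, A 0 j.succ ≤ 0 := fun j => hZ _ _ (Fin.succ_ne_zero j).symm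
  refine isMMatrix_iff.2 ⟨fun i j hij => ?_, fun ε hε => ?_⟩
  · have h1 : A i.succ j.succ ≤ 0 := hZ _ _ fun e => hij (Fin.succ_injective _ e)
    have h2 : 0 ≤ A i.succ 0 * A 0 j.succ / A 0 0 :=
      div_nonneg (mul_nonneg_of_nonpos_of_nonpos (hc i) (hr j)) h0.le
    rw [schur_apply]
    linarith
  -- A shift by `δ` of the leading entry amounts to the factor `1 + δ / a` on the other rows.
  obtain ⟨δ, hδ, hδ1, hδε⟩ := exists_pos_forall_mul_le
    (fun i : Fin n => A i.succ i.succ / A 0 0 + (1 + 1 / A 0 0)) (fun _ => ε) fun _ => hε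
  obtain ⟨x, hx, hAx⟩ := hpos δ hδ
  refine ⟨fun i => x i.succ, fun i => hx _, fun i => ?_⟩
  have e0 := hAx 0
  have ei := hAx i.succ
  have hd := mulVec_le_diag hB (x := fun i => x i.succ) (fun i => hx _) i
  simp only [Matrix.mulVec, dotProduct, Fin.sum_univ_succ (n := n), Matrix.submatrix_apply]
    at e0 ei hd
  rw [schur_mulVec]
  set b := ∑ j : Fin n, A i.succ j.succ * x j.succ
  set r := ∑ j : Fin n, A 0 j.succ * x j.succ
  set a := A 0 0
  set d := δ / a
  have hd0 : 0 < d := div_pos hδ h0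
  have hda : d * a = δ := div_mul_cancel₀ _ h0.ne'
  have h1 : A i.succ 0 * r / a ≤ -(A i.succ 0 * x 0 * (1 + d)) := by
    rw [div_le_iff₀ h0]
    have := mul_le_mul_of_nonpos_left (show -((a + δ) * x 0) ≤ r by linarith) (hc i)
    rw [← hda] at this
    linarith
  have h2 := mul_nonneg (show 0 ≤ 1 + d by linarith) ei
  have h3 := mul_le_mul_of_nonneg_left hd hd0.le
  have h4 : d * A i.succ i.succ + (1 + d) * δ ≤ ε := by
    refine le_trans ?_ (hδε i)
    have : d * δ ≤ d * 1 := mul_le_mul_of_nonneg_left hδ1 hd0.le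
    have e : (A i.succ i.succ / a + (1 + 1 / a)) * δ = d * A i.succ i.succ + δ + d := by
      simp only [d]
      ring
    rw [e]
    linarith
  have h5 := mul_le_mul_of_nonneg_right h4 (hx i.succ).le
  linarith

/-! ### Access and singular classes under elimination -/

theorem hasAccess_transpose {n : ℕ} {A : Matrix (Fin n) (Fin n) ℝ} {i j : Fin n} :
    HasAccess Aᵀ i j ↔ HasAccess A j i :=
  Relation.reflTransGen_swap (r := Edge A)

theorem communicate_transpose {n : ℕ} {A : Matrix (Fin n) (Fin n) ℝ} {i j : Fin n} :
    Communicate Aᵀ i j ↔ Communicate A i j := by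
  rw [Communicate, Communicate, hasAccess_transpose, hasAccess_transpose, and_comm]

/-- `k` is the maximum of a singular class of `A`. Singularity is expressed by a kernel vector of
the principal submatrix, extended by zero. -/
def IsSingularMax {n : ℕ} (A : Matrix (Fin n) (Fin n) ℝ) (k : Fin n) : Prop :=
  (∀ w, Communicate A k w → w ≤ k) ∧ ∃ z : Fin n → ℝ, z ≠ 0 ∧
    (∀ i, ¬ Communicate A k i → z i = 0) ∧ ∀ i, Communicate A k i → (A *ᵥ z) i = 0

theorem hasAccess_of_submatrix_succ {n : ℕ} {A : Matrix (Fin (n + 1)) (Fin (n + 1)) ℝ}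
    {i j : Fin n} (h : HasAccess (A.submatrix Fin.succ Fin.succ) i j) :
    HasAccess A i.succ j.succ := by
  induction h with
  | refl => exact .refl
  | tail _ hbc ih => exact ih.tail hbc

theorem communicate_submatrix_succ {n : ℕ} {A : Matrix (Fin (n + 1)) (Fin (n + 1)) ℝ}
    (h0 : ∀ j : Fin n, ¬ Communicate A 0 j.succ) {i j : Fin n} :
    Communicate (A.submatrix Fin.succ Fin.succ) i j ↔ Communicate A i.succ j.succ := by
  have key : ∀ (i : Fin n) v, HasAccess A i.succ v → HasAccess A v i.succ →
      ∀ j, v = j.succ → HasAccess (A.submatrix Fin.succ Fin.succ) i j := by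
    intro i v h
    induction h with
    | refl =>
      intro _ j hj
      rw [Fin.succ_injective _ hj]
      exact .refl
    | @tail b c hb hbc ih =>
      intro hc j hj
      have hbi := hc.head hbc
      cases b using Fin.cases with
      | zero => exact absurd ⟨hbi, hb⟩ (h0 i)
      | succ b =>
        subst hj
        exact (ih hbi b rfl).tail hbc
  exact ⟨fun h => ⟨hasAccess_of_submatrix_succ h.1, hasAccess_of_submatrix_succ h.2⟩,
    fun h => ⟨key i _ h.1 h.2 j rfl, key j _ h.2 h.1 i rfl⟩⟩

theorem isSingularMax_of_submatrix_succ {n : ℕ} {A : Matrix (Fin (n + 1)) (Fin (n + 1)) ℝ}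
    (h0 : ∀ j : Fin n, ¬ Communicate A 0 j.succ) {k : Fin n}
    (h : IsSingularMax (A.submatrix Fin.succ Fin.succ) k) : IsSingularMax A k.succ := by
  obtain ⟨hk, z, hz, hzs, hAz⟩ := h
  have hk0 : ¬ Communicate A k.succ 0 := fun h => h0 k ⟨h.2, h.1⟩
  refine ⟨fun w hw => ?_, Fin.cons 0 z, fun e => hz ?_, fun i hi => ?_, fun i hi => ?_⟩
  · cases w using Fin.cases with
    | zero => exact Fin.zero_le _
    | succ w => exact Fin.succ_le_succ_iff.2 (hk w ((communicate_submatrix_succ h0).2 hw))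
  · ext i
    simpa using congrFun e i.succ
  · cases i using Fin.cases with
    | zero => rfl
    | succ i => exact hzs i fun h => hi ((communicate_submatrix_succ h0).1 h)
  · cases i using Fin.cases with
    | zero => exact absurd hi hk0
    | succ i =>
      have := hAz i ((communicate_submatrix_succ h0).2 hi)
      simpa [Matrix.mulVec, dotProduct, Fin.sum_univ_succ (n := n)] using this

theorem isSingularMax_zero {n : ℕ} {A : Matrix (Fin (n + 1)) (Fin (n + 1)) ℝ}
    (h0 : ∀ j : Fin n, ¬ Communicate A 0 j.succ) (hA : A 0 0 = 0) : IsSingularMax A 0 := by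
  refine ⟨fun w hw => ?_, Pi.single 0 1, by simp, fun i hi => ?_, fun i hi => ?_⟩
  · cases w using Fin.cases with
    | zero => exact le_rfl
    | succ w => exact absurd hw (h0 w)
  · cases i using Fin.cases with
    | zero => exact absurd ⟨.refl, .refl⟩ hi
    | succ i => simp
  · cases i using Fin.cases with
    | zero => simp [hA]
    | succ i => exact absurd hi (h0 i)

theorem hasAccess_of_schur {n : ℕ} {A : Matrix (Fin (n + 1)) (Fin (n + 1)) ℝ} {i j : Fin n}
    (h : HasAccess (schur A) i j) : HasAccess A i.succ j.succ := by
  induction h with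
  | refl => exact .refl
  | @tail b c _ hbc ih =>
    by_cases h1 : A b.succ c.succ = 0
    · have h2 : A b.succ 0 ≠ 0 ∧ A 0 c.succ ≠ 0 := by
        rw [← mul_ne_zero_iff]
        intro h2
        exact hbc (by rw [schur_apply, h1, h2, zero_div, sub_zero])
      exact (ih.tail h2.1).tail h2.2
    · exact ih.tail h1

/-- Off the diagonal no cancellation occurs in the Schur complement, so that a path through the
index `0` leaves an edge behind. -/
theorem hasAccess_schur {n : ℕ} {A : Matrix (Fin (n + 1)) (Fin (n + 1)) ℝ}
    (hZ : ∀ i j, i ≠ j → A i j ≤ 0) (ha : 0 < A 0 0) {i j : Fin n} :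
    HasAccess (schur A) i j ↔ HasAccess A i.succ j.succ := by
  refine ⟨hasAccess_of_schur, fun h => ?_⟩
  have hc : ∀ i : Fin n, A i.succ 0 ≤ 0 := fun i => hZ _ _ (Fin.succ_ne_zero i)
  have hr : ∀ j : Fin n, A 0 j.succ ≤ 0 := fun j => hZ _ _ (Fin.succ_ne_zero j).symm
  have edge : ∀ b c : Fin n, (A b.succ c.succ ≠ 0 ∨ A b.succ 0 ≠ 0 ∧ A 0 c.succ ≠ 0) →
      HasAccess (schur A) b c := by
    intro b c h
    by_cases hbc : b = c
    · exact hbc ▸ .refl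
    refine .single (ne_of_lt ?_)
    have h1 : A b.succ c.succ ≤ 0 := hZ _ _ fun e => hbc (Fin.succ_injective _ e)
    have h2 : 0 ≤ A b.succ 0 * A 0 c.succ / A 0 0 :=
      div_nonneg (mul_nonneg_of_nonpos_of_nonpos (hc b) (hr c)) ha.le
    rw [schur_apply]
    rcases h with h | h
    · have := lt_of_le_of_ne h1 h
      linarith
    · have := lt_of_le_of_ne h2 (div_ne_zero (mul_ne_zero h.1 h.2) ha.ne').symm
      linarith
  have key : ∀ v, HasAccess A i.succ v → (∀ j, v = j.succ → HasAccess (schur A) i j) ∧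
      (v = 0 → ∃ k : Fin n, HasAccess (schur A) i k ∧ A k.succ 0 ≠ 0) := by
    intro v h
    induction h with
    | refl =>
      refine ⟨fun j hj => ?_, fun h => absurd h (Fin.succ_ne_zero i)⟩
      rw [Fin.succ_injective _ hj]
      exact .refl
    | @tail b c _ hbc ih =>
      cases b using Fin.cases with
      | zero =>
        obtain ⟨k, hk, hk0⟩ := ih.2 rfl
        exact ⟨fun j hj => hk.trans (edge k j (.inr ⟨hk0, hj ▸ hbc⟩)), fun _ => ⟨k, hk, hk0⟩⟩
      | succ b =>
        have hb := ih.1 b rfl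
        exact ⟨fun j hj => hb.trans (edge b j (.inl (hj ▸ hbc))), fun hc => ⟨b, hb, hc ▸ hbc⟩⟩
  exact (key _ h).1 j rfl

theorem isSingularMax_of_schur {n : ℕ} {A : Matrix (Fin (n + 1)) (Fin (n + 1)) ℝ}
    (hZ : ∀ i j, i ≠ j → A i j ≤ 0) (ha : 0 < A 0 0) {k : Fin n}
    (h : IsSingularMax (schur A) k) : IsSingularMax A k.succ := by
  classical
  obtain ⟨hk, z, hz, hzs, hAz⟩ := h
  have hcomm : ∀ i, Communicate (schur A) k i ↔ Communicate A k.succ i.succ := fun i =>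
    and_congr (hasAccess_schur hZ ha) (hasAccess_schur hZ ha)
  let t : ℝ := if Communicate A k.succ 0 then -(∑ j, A 0 j.succ * z j) / A 0 0 else 0
  refine ⟨fun w hw => ?_, Fin.cons t z, fun e => hz ?_, fun i hi => ?_, fun i hi => ?_⟩
  · cases w using Fin.cases with
    | zero => exact Fin.zero_le _
    | succ w => exact Fin.succ_le_succ_iff.2 (hk w ((hcomm w).2 hw))
  · ext i
    simpa using congrFun e i.succ
  · cases i using Fin.cases with
    | zero => exact if_neg hi
    | succ i => exact hzs i fun h => hi ((hcomm i).1 h)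
  · cases i using Fin.cases with
    | zero =>
      have ht : t = -(∑ j, A 0 j.succ * z j) / A 0 0 := if_pos hi
      simp only [Matrix.mulVec, dotProduct, Fin.sum_univ_succ (n := n), Fin.cons_zero,
        Fin.cons_succ, ht]
      rw [mul_div_cancel₀ _ ha.ne', neg_add_cancel]
    | succ i =>
      have e := hAz i ((hcomm i).2 hi)
      rw [schur_mulVec] at e
      simp only [Matrix.mulVec, dotProduct, Fin.sum_univ_succ (n := n), Fin.cons_zero,
        Fin.cons_succ]
      by_cases h0 : Communicate A k.succ 0
      · have ht : t = -(∑ j, A 0 j.succ * z j) / A 0 0 := if_pos h0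
        rw [ht, ← e]
        ring
      · have ht : t = 0 := if_neg h0
        -- A path `i → 0 → j` inside the class of `k` would put `0` into this class.
        have hr : A i.succ 0 * ∑ j, A 0 j.succ * z j = 0 := by
          rw [Finset.mul_sum]
          refine Finset.sum_eq_zero fun j _ => ?_
          by_contra hne
          rw [← ne_eq, mul_ne_zero_iff, mul_ne_zero_iff] at hne
          have hj : Communicate A k.succ j.succ :=
            (hcomm j).1 (by_contra fun h => hne.2.2 (hzs j h))
          exact h0 ⟨hi.1.tail hne.1, hj.2.head hne.2.1⟩
        rw [hr, zero_div, sub_zero] at e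
        rw [ht, e, mul_zero, add_zero]

/-! ### Block LU factorization by elimination -/

/-- `U` qualifies as the right factor of a block LU factorization of `A` with blocks generated by
the set `N` of maxima of singular classes. Applied to `Aᵀ` and `Lᵀ`, it describes the left factor.
The field `solvable` records that `U` is regular away from the classes with maximum in `N`. -/
structure IsRightFactor {n : ℕ} (A U : Matrix (Fin n) (Fin n) ℝ) (N : Set (Fin n)) : Prop where
  isMMatrix : IsMMatrix U
  hasAccess : ∀ {i j}, U i j ≠ 0 → HasAccess A i j
  covered : ∀ {i j l}, U i j ≠ 0 → j ≤ l → l < i →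
    ∃ k ∈ N, IsSingularMax A k ∧ k ≤ l ∧ ∃ p, l < p ∧ HasAccess A p k
  solvable : ∀ r : Fin n → ℝ, (∀ i, 0 ≤ r i) →
    (∀ i k, r i ≠ 0 → HasAccess A i k → IsSingularMax A k → k ∉ N) →
    ∃ x : Fin n → ℝ, (∀ i, 0 ≤ x i) ∧ x ᵥ* U = r ∧
      ∀ j, x j ≠ 0 → ∃ i, r i ≠ 0 ∧ HasAccess A i j

section

variable {n : ℕ} {A : Matrix (Fin (n + 1)) (Fin (n + 1)) ℝ} {X U : Matrix (Fin n) (Fin n) ℝ}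
  {N : Set (Fin (n + 1))} {N' : Set (Fin n)}

/-- One step of triangular elimination. Here `X` is what remains of `A` without the index `0`: the
Schur complement or the trailing principal submatrix. -/
theorem IsRightFactor.border (hU : IsRightFactor X U N')
    (hacc : ∀ {i j}, HasAccess X i j → HasAccess A i.succ j.succ)
    (hsing : ∀ {k}, IsSingularMax X k → IsSingularMax A k.succ)
    (hN : ∀ {k}, k ∈ N' → k.succ ∈ N)
    {p : ℝ} (hp : 0 < p) {q : Fin n → ℝ} (hq : ∀ j, q j ≤ 0)
    (hqA : ∀ j, q j ≠ 0 → HasAccess A 0 j.succ) :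
    IsRightFactor A (border p q 0 U) N where
  isMMatrix := isMMatrix_border hU.isMMatrix hp.le hq (fun _ => le_rfl) Set.univ
    (fun _ _ => trivial) (fun _ _ _ _ => trivial) fun _ _ => rfl
  hasAccess {i j} h := by
    cases i using Fin.cases with
    | zero =>
      cases j using Fin.cases with
      | zero => exact .refl
      | succ j => exact hqA j h
    | succ i =>
      cases j using Fin.cases with
      | zero => exact absurd rfl h
      | succ j => exact hacc (hU.hasAccess h)
  covered {i j l} h hjl hli := by
    cases i using Fin.cases with
    | zero => exact absurd hli (Fin.not_lt_zero l)
    | succ i =>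
      cases j using Fin.cases with
      | zero => exact absurd rfl h
      | succ j =>
        cases l using Fin.cases with
        | zero => exact absurd hjl (not_le.2 (Fin.succ_pos j))
        | succ l =>
          obtain ⟨k, hk, hks, hkl, m, hlm, hmk⟩ := hU.covered h (Fin.succ_le_succ_iff.1 hjl)
            (Fin.succ_lt_succ_iff.1 hli)
          exact ⟨k.succ, hN hk, hsing hks, Fin.succ_le_succ_iff.2 hkl, m.succ,
            Fin.succ_lt_succ_iff.2 hlm, hacc hmk⟩
  solvable r hr hrN := by
    have hx0 : 0 ≤ r 0 / p := div_nonneg (hr 0) hp.le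
    have hpos : ∀ j, 0 ≤ -(r 0 / p * q j) := fun j =>
      neg_nonneg.2 (mul_nonpos_of_nonneg_of_nonpos hx0 (hq j))
    have hsupp : ∀ i, r i.succ - r 0 / p * q i ≠ 0 → ∃ i', r i' ≠ 0 ∧ HasAccess A i' i.succ := by
      intro i hi
      by_cases h1 : r i.succ = 0
      · have h2 : r 0 / p * q i ≠ 0 := fun h2 => hi (by rw [h1, h2, sub_zero])
        rw [mul_ne_zero_iff] at h2
        exact ⟨0, fun e => h2.1 (by rw [e, zero_div]), hqA i h2.2⟩
      · exact ⟨i.succ, h1, .refl⟩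
    obtain ⟨x, hx, hxU, hxs⟩ := hU.solvable (fun j => r j.succ - r 0 / p * q j)
      (fun j => by linarith [hr j.succ, hpos j]) fun i k hi hik hk hkN => by
        obtain ⟨i', hi', hi'i⟩ := hsupp i hi
        exact hrN i' k.succ hi' (hi'i.trans (hacc hik)) (hsing hk) (hN hkN)
    refine ⟨Fin.cons (r 0 / p) x, fun i => ?_, funext fun j => ?_, fun j hj => ?_⟩
    · cases i using Fin.cases with
      | zero => exact hx0
      | succ i => exact hx i
    · cases j using Fin.cases with
      | zero => simp [Matrix.vecMul, dotProduct, Fin.sum_univ_succ, hp.ne']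
      | succ j =>
        have := congrFun hxU j
        simp only [Matrix.vecMul, dotProduct] at this
        simp [Matrix.vecMul, dotProduct, Fin.sum_univ_succ, this]
    · cases j using Fin.cases with
      | zero => exact ⟨0, fun e => hj (by simp [e]), .refl⟩
      | succ j =>
        obtain ⟨i, hi, hij⟩ := hxs j hj
        obtain ⟨i', hi', hi'i⟩ := hsupp i hi
        exact ⟨i', hi', hi'i.trans (hacc hij)⟩

/-- The factor that absorbs a zero leading entry of `A`. Classes with access to the index `0` may
be singular in `U`, as their blocks are contained in the one that `0` generates. -/
theorem IsRightFactor.border_zero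
    (hU : IsRightFactor (A.submatrix Fin.succ Fin.succ) U
      {k | k.succ ∈ N ∨ HasAccess A k.succ 0})
    (hA : A 0 0 = 0) (h0 : ∀ j : Fin n, ¬ Communicate A 0 j.succ) (h0N : 0 ∈ N)
    {q c : Fin n → ℝ} (hq : ∀ j, q j ≤ 0) (hc : ∀ i, c i ≤ 0)
    (hqA : ∀ j, q j ≠ 0 → HasAccess A 0 j.succ) (hcA : ∀ i, c i ≠ 0 → HasAccess A i.succ 0) :
    IsRightFactor A (BlockLU.border 0 q c U) N where
  isMMatrix := isMMatrix_border hU.isMMatrix le_rfl hq hc {j | HasAccess A 0 j.succ} hqA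
    (fun i j hi hij => hi.trans (hasAccess_of_submatrix_succ (hU.hasAccess hij)))
    fun i hi => by_contra fun hci => h0 i ⟨hi, hcA i hci⟩
  hasAccess {i j} h := by
    cases i using Fin.cases with
    | zero =>
      cases j using Fin.cases with
      | zero => exact .refl
      | succ j => exact hqA j h
    | succ i =>
      cases j using Fin.cases with
      | zero => exact hcA i h
      | succ j => exact hasAccess_of_submatrix_succ (hU.hasAccess h)
  covered {i j l} h hjl hli := by
    have hs0 := isSingularMax_zero h0 hA
    cases i using Fin.cases with
    | zero => exact absurd hli (Fin.not_lt_zero l)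
    | succ i =>
      cases j using Fin.cases with
      | zero => exact ⟨0, h0N, hs0, Fin.zero_le _, i.succ, hli, hcA i h⟩
      | succ j =>
        cases l using Fin.cases with
        | zero => exact absurd hjl (not_le.2 (Fin.succ_pos j))
        | succ l =>
          obtain ⟨k, hk, hks, hkl, m, hlm, hmk⟩ := hU.covered h (Fin.succ_le_succ_iff.1 hjl)
            (Fin.succ_lt_succ_iff.1 hli)
          have hmk' := hasAccess_of_submatrix_succ hmk
          rcases hk with hk | hk
          · exact ⟨k.succ, hk, isSingularMax_of_submatrix_succ h0 hks,
              Fin.succ_le_succ_iff.2 hkl, m.succ, Fin.succ_lt_succ_iff.2 hlm, hmk'⟩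
          · exact ⟨0, h0N, hs0, Fin.zero_le _, m.succ, Fin.succ_lt_succ_iff.2 hlm,
              hmk'.trans hk⟩
  solvable r hr hrN := by
    have hs0 := isSingularMax_zero h0 hA
    have hr0 : ∀ i, r i ≠ 0 → ¬ HasAccess A i 0 := fun i hi hi0 => hrN i 0 hi hi0 hs0 h0N
    have hr00 : r 0 = 0 := by_contra fun h => hr0 0 h .refl
    obtain ⟨x, hx, hxU, hxs⟩ := hU.solvable (fun j => r j.succ) (fun j => hr j.succ)
      fun i k hi hik hk hkN => by
        have hik' := hasAccess_of_submatrix_succ hik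
        rcases hkN with hkN | hkN
        · exact hrN i.succ k.succ hi hik' (isSingularMax_of_submatrix_succ h0 hk) hkN
        · exact hr0 i.succ hi (hik'.trans hkN)
    have hxc : ∀ j, x j * c j = 0 := fun j => by
      by_contra hne
      rw [← ne_eq, mul_ne_zero_iff] at hne
      obtain ⟨i, hi, hij⟩ := hxs j hne.1
      exact hr0 i.succ hi ((hasAccess_of_submatrix_succ hij).trans (hcA j hne.2))
    refine ⟨Fin.cons 0 x, fun i => ?_, funext fun j => ?_, fun j hj => ?_⟩
    · cases i using Fin.cases with
      | zero => exact le_rfl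
      | succ i => exact hx i
    · cases j using Fin.cases with
      | zero => simp [Matrix.vecMul, dotProduct, Fin.sum_univ_succ, hxc, hr00]
      | succ j =>
        have := congrFun hxU j
        simp only [Matrix.vecMul, dotProduct] at this
        simp [Matrix.vecMul, dotProduct, Fin.sum_univ_succ, this]
    · cases j using Fin.cases with
      | zero => exact absurd rfl hj
      | succ j =>
        obtain ⟨i, hi, hij⟩ := hxs j hj
        exact ⟨i.succ, hi, hasAccess_of_submatrix_succ hij⟩

end

/-- `A` is the product of an admissible left factor, with blocks generated by the maxima of
singular classes in `J`, and an admissible right factor, with blocks generated by the others. -/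
def HasFactorization {n : ℕ} (A : Matrix (Fin n) (Fin n) ℝ) (J : Set (Fin n)) : Prop :=
  ∃ L U : Matrix (Fin n) (Fin n) ℝ, A = L * U ∧ IsRightFactor Aᵀ Lᵀ J ∧ IsRightFactor A U Jᶜ

theorem HasFactorization.of_transpose {n : ℕ} {A : Matrix (Fin n) (Fin n) ℝ} {J : Set (Fin n)}
    (h : HasFactorization Aᵀ Jᶜ) : HasFactorization A J := by
  obtain ⟨L, U, hLU, hL, hU⟩ := h
  rw [Matrix.transpose_transpose] at hL
  rw [compl_compl] at hU
  refine ⟨Uᵀ, Lᵀ, ?_, by rwa [Matrix.transpose_transpose], hL⟩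
  rw [← Matrix.transpose_mul, ← hLU, Matrix.transpose_transpose]

theorem hasFactorization_of_pos {n : ℕ} {A : Matrix (Fin (n + 1)) (Fin (n + 1)) ℝ}
    (hA : IsMMatrix A) (ha : 0 < A 0 0) {J : Set (Fin (n + 1))}
    (h : HasFactorization (schur A) {k | k.succ ∈ J}) : HasFactorization A J := by
  obtain ⟨L, U, hLU, hL, hU⟩ := h
  have hZ := (isMMatrix_iff.1 hA).1
  have hc : ∀ i : Fin n, A i.succ 0 ≤ 0 := fun i => hZ _ _ (Fin.succ_ne_zero i)
  have hr : ∀ j : Fin n, A 0 j.succ ≤ 0 := fun j => hZ _ _ (Fin.succ_ne_zero j).symm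
  refine ⟨border 1 0 (fun i => A i.succ 0 / A 0 0) L, border (A 0 0) (fun j => A 0 j.succ) 0 U,
    ?_, ?_, ?_⟩
  · have hLU' : ∀ i j, ∑ l, L i l * U l j = schur A i j := fun i j => by
      rw [hLU, Matrix.mul_apply]
    ext i j
    rw [Matrix.mul_apply, Fin.sum_univ_succ]
    cases i using Fin.cases <;> cases j using Fin.cases <;>
      simp [hLU', schur_apply, ha.ne', div_mul_eq_mul_div]
  · rw [border_transpose]
    rw [← schur_transpose] at hL
    exact hL.border hasAccess_of_schur
      (isSingularMax_of_schur (fun i j hij => hZ j i hij.symm) ha) (fun hk => hk) one_pos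
      (fun j => div_nonpos_of_nonpos_of_nonneg (hc j) ha.le)
      fun j hj => .single fun e => hj (by rw [show A j.succ 0 = 0 from e, zero_div])
  · exact hU.border hasAccess_of_schur (isSingularMax_of_schur hZ ha) (fun hk => hk) ha hr
      fun j hj => .single hj

theorem hasFactorization_of_zero_mem {n : ℕ} {A : Matrix (Fin (n + 1)) (Fin (n + 1)) ℝ}
    (hA : IsMMatrix A) (ha : A 0 0 = 0) {J : Set (Fin (n + 1))} (h0J : 0 ∈ J)
    (h : HasFactorization (A.submatrix Fin.succ Fin.succ)
      {k | k.succ ∈ J ∨ HasAccess A 0 k.succ}) : HasFactorization A J := by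
  obtain ⟨L, U, hLU, hL, hU⟩ := h
  have hZ := (isMMatrix_iff.1 hA).1
  have h0 : ∀ j : Fin n, ¬ Communicate A 0 j.succ := by
    rintro j ⟨h1, h2⟩
    obtain e | ⟨v, h0v, hv⟩ := Relation.ReflTransGen.cases_head h1
    · exact Fin.succ_ne_zero j e.symm
    · exact hA.not_hasAccess_of_diag_eq_zero ha h0v (hv.trans h2)
  have h0' : ∀ j : Fin n, ¬ Communicate Aᵀ 0 j.succ := fun j => by
    rw [communicate_transpose]
    exact h0 j
  have hc : ∀ i : Fin n, A i.succ 0 ≤ 0 := fun i => hZ _ _ (Fin.succ_ne_zero i)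
  have hr : ∀ j : Fin n, A 0 j.succ ≤ 0 := fun j => hZ _ _ (Fin.succ_ne_zero j).symm
  -- The first row of `A` becomes `-x U`; this is solvable as all classes accessed from `0` have
  -- been assigned to the left factor.
  obtain ⟨x, hx, hxU, hxs⟩ := hU.solvable (fun j => -A 0 j.succ)
    (fun j => neg_nonneg.2 (hr j)) fun i k hi hik _ hk => hk (.inr
      ((hasAccess_of_submatrix_succ hik).head (neg_ne_zero.1 hi : Edge A 0 i.succ)))
  refine ⟨border 0 (fun j => -x j) (fun i => A i.succ 0) L, border 1 0 0 U, ?_, ?_, ?_⟩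
  · have hLU' : ∀ i j, ∑ l, L i l * U l j = A i.succ j.succ := fun i j => by
      rw [← Matrix.mul_apply, ← hLU, Matrix.submatrix_apply]
    have hxU' : ∀ j, ∑ l, x l * U l j = -A 0 j.succ := fun j => congrFun hxU j
    ext i j
    rw [Matrix.mul_apply, Fin.sum_univ_succ]
    cases i using Fin.cases <;> cases j using Fin.cases <;> simp [hLU', hxU', ha]
  · rw [border_transpose]
    refine IsRightFactor.border_zero (A := Aᵀ) ?_ ha h0' h0J hc (fun j => neg_nonpos.2 (hx j))
      (fun j hj => .single hj) fun j hj => ?_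
    · rw [Matrix.transpose_submatrix] at hL
      simpa only [hasAccess_transpose] using hL
    · obtain ⟨i, hi, hij⟩ := hxs j (neg_ne_zero.1 hj)
      exact hasAccess_transpose.2
        ((hasAccess_of_submatrix_succ hij).head (neg_ne_zero.1 hi : Edge A 0 i.succ))
  · exact hU.border hasAccess_of_submatrix_succ (isSingularMax_of_submatrix_succ h0) (N := Jᶜ)
      (fun hk hkJ => hk (.inl hkJ)) one_pos (fun _ => le_rfl) fun j hj => absurd rfl hj

theorem IsMMatrix.hasFactorization {n : ℕ} {A : Matrix (Fin n) (Fin n) ℝ} (hA : IsMMatrix A)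
    (J : Set (Fin n)) : HasFactorization A J := by
  induction n with
  | zero =>
    have h : ∀ (X : Matrix (Fin 0) (Fin 0) ℝ) N, IsRightFactor X 1 N := fun X N =>
      ⟨Subsingleton.elim A 1 ▸ hA, fun {i} => i.elim0, fun {i} => i.elim0, fun r _ _ =>
        ⟨r, fun i => i.elim0, Subsingleton.elim _ _, fun i => i.elim0⟩⟩
    exact ⟨1, 1, Subsingleton.elim _ _, by simpa using h _ _, h _ _⟩
  | succ n ih =>
    rcases (hA.diag_nonneg 0).lt_or_eq with ha | ha
    · exact hasFactorization_of_pos hA ha (ih (hA.schur ha) _)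
    · by_cases h0J : 0 ∈ J
      · exact hasFactorization_of_zero_mem hA ha.symm h0J (ih hA.submatrix_succ _)
      · -- The class `{0}` belongs to the right factor of `A`, so to the left factor of `Aᵀ`.
        exact .of_transpose
          (hasFactorization_of_zero_mem hA.transpose ha.symm h0J (ih hA.transpose.submatrix_succ _))

/-! ### The induced partitions -/

theorem IsSingularMax.exists_isSingularClass {n : ℕ} {A : Matrix (Fin n) (Fin n) ℝ} {k : Fin n}
    (h : IsSingularMax A k) : ∃ C, IsSingularClass A C ∧ C.max = k := by
  classical
  obtain ⟨hk, z, hz, hzs, hAz⟩ := h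
  have hC : ∀ w, w ∈ univ.filter (Communicate A k) ↔ Communicate A k w := by simp
  refine ⟨univ.filter (Communicate A k), ⟨⟨k, hC⟩, ?_⟩, le_antisymm ?_ ?_⟩
  · refine Matrix.exists_mulVec_eq_zero_iff.1 ⟨fun i => z i, fun e => hz ?_, funext fun i => ?_⟩
    · ext i
      by_cases hi : Communicate A k i
      · exact congrFun e ⟨i, (hC i).2 hi⟩
      · exact hzs i hi
    · refine Eq.trans ?_ (hAz i ((hC i).1 i.2))
      simp only [Matrix.mulVec, dotProduct, Matrix.submatrix_apply]
      rw [Finset.sum_coe_sort _ fun j => A i j * z j]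
      exact Finset.sum_subset (subset_univ _) fun j _ hj => by
        rw [hzs j fun h => hj ((hC j).2 h), mul_zero]
  · exact Finset.max_le fun w hw => WithBot.coe_le_coe.2 (hk w ((hC w).1 hw))
  · exact Finset.le_max ((hC k).2 ⟨.refl, .refl⟩)

/-- Two indices lie in the same part of the finest encompassing partition if any two consecutive
indices between them lie in a common set of the family. -/
theorem part_finestEncompassing_eq {n : ℕ} {ι : Type*} {J : Finset ι}
    {F : ι → Finset (Fin n)} {i j : Fin n} (hij : i ≤ j)
    (h : ∀ l l' : Fin n, i ≤ l → l' ≤ j → (l' : ℕ) = l + 1 → ∃ s ∈ J, l ∈ F s ∧ l' ∈ F s) :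
    (finestEncompassing J F).part i = (finestEncompassing J F).part j := by
  rw [finestEncompassing, part_glbPartition_eq_iff]
  intro P _ hP
  have key : ∀ d : ℕ, ∀ l : Fin n, (l : ℕ) = i + d → l ≤ j → P.part i = P.part l := by
    intro d
    induction d with
    | zero =>
      intro l hl _
      rw [show i = l from Fin.ext hl.symm]
    | succ d ih =>
      intro l hl hlj
      have hd : (i : ℕ) + d < n := by omega
      have hlv : (l : ℕ) = (⟨i + d, hd⟩ : Fin n) + 1 := by simp only [hl]; omega
      rw [ih ⟨i + d, hd⟩ rfl (by rw [Fin.le_def] at hlj ⊢; omega)]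
      obtain ⟨s, hs, h1, h2⟩ := h ⟨i + d, hd⟩ l (by rw [Fin.le_def]; omega) hlj hlv
      obtain ⟨v, hv, hFv⟩ := hP s hs
      rw [P.part_eq_of_mem hv (hFv h1), P.part_eq_of_mem hv (hFv h2)]
  have hij' : (i : ℕ) ≤ j := hij
  exact key (j - i) j (by omega) le_rfl

theorem mem_accessedFrom_of_le {n : ℕ} {X : Matrix (Fin n) (Fin n) ℝ} {C : Finset (Fin n)}
    {k l j : Fin n} (hC : C.max = k) (hkl : k ≤ l) (hlj : l ≤ j) (h : HasAccess X k j) :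
    l ∈ accessedFrom X C := by
  classical
  simp only [accessedFrom, mem_filter_univ]
  exact ⟨hC.trans_le (WithBot.coe_le_coe.2 hkl), j, hlj, k, Finset.mem_of_max hC, h⟩

theorem accessTo_eq {n : ℕ} (X : Matrix (Fin n) (Fin n) ℝ) (C : Finset (Fin n)) :
    accessTo X C = accessedFrom Xᵀ C := by
  classical
  simp only [accessTo, accessedFrom, hasAccess_transpose]

theorem IsRightFactor.upper_refinement {n : ℕ} {A U : Matrix (Fin n) (Fin n) ℝ}
    {N : Set (Fin n)} (hU : IsRightFactor A U N) {ι : Type*} {K : Finset ι}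
    {S : ι → Finset (Fin n)}
    (hK : ∀ k ∈ N, IsSingularMax A k → ∃ s ∈ K, (S s).max = k) :
    IsRefinement (upperSelfPartition U) (finestEncompassing K fun s => accessTo A (S s)) := by
  refine ⟨isOrderPreserving_glbPartition _, glbPartition_le (isOrderPreserving_glbPartition _)
    ((isBlockUpper_iff (isOrderPreserving_glbPartition _)).2 fun i j hji hne => ?_)⟩
  by_contra hUij
  refine hne (part_finestEncompassing_eq hji.le fun l l' hl hl' hll' => ?_)
  have hlt : l < l' := Fin.lt_def.2 (by omega)
  obtain ⟨k, hk, hks, hkl, p, hlp, hpk⟩ := hU.covered hUij hl (hlt.trans_le hl')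
  obtain ⟨s, hs, hsk⟩ := hK k hk hks
  have hl'p : l' ≤ p := Fin.le_def.2 (by rw [Fin.lt_def] at hlp; omega)
  simp only [accessTo_eq]
  exact ⟨s, hs, mem_accessedFrom_of_le hsk hkl hlp.le (hasAccess_transpose.2 hpk),
    mem_accessedFrom_of_le hsk (hkl.trans hlt.le) hl'p (hasAccess_transpose.2 hpk)⟩

theorem upperSelfPartition_transpose {n : ℕ} (X : Matrix (Fin n) (Fin n) ℝ) :
    upperSelfPartition Xᵀ = lowerSelfPartition X := by
  have : IsBlockUpper Xᵀ = IsBlockLower X := by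
    ext P
    exact ⟨fun h v hv i hi j hj => h v hv j hj i hi, fun h v hv i hi j hj => h v hv j hj i hi⟩
  rw [upperSelfPartition, this, lowerSelfPartition]

end BlockLU

theorem theorem3p5 {n : ℕ} (A : Matrix (Fin n) (Fin n) ℝ) (hA : BlockLU.IsMMatrix A)
    {m : ℕ} (S : Fin m → Finset (Fin n)) (hS : BlockLU.IsSingularClassList A S)
    (J K : Finset (Fin m)) (hJK : J ∪ K = Finset.univ) (hdisj : Disjoint J K) :
    ∃ L U : Matrix (Fin n) (Fin n) ℝ,
      A = L * U ∧ BlockLU.IsMMatrix L ∧ BlockLU.IsMMatrix U ∧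
      BlockLU.IsRefinement (BlockLU.lowerSelfPartition L)
        (BlockLU.finestEncompassing J fun i => BlockLU.accessedFrom A (S i)) ∧
      BlockLU.IsRefinement (BlockLU.upperSelfPartition U)
        (BlockLU.finestEncompassing K fun i => BlockLU.accessTo A (S i)) := by
  obtain ⟨L, U, hLU, hL, hU⟩ :=
    hA.hasFactorization {k | ∃ i ∈ J, (S i).max = (k : WithBot (Fin n))}
  refine ⟨L, U, hLU, hL.isMMatrix.transpose, hU.isMMatrix, ?_, hU.upper_refinement ?_⟩
  · have := hL.upper_refinement (K := J) (S := S) fun k hk _ => hk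
    simpa only [BlockLU.upperSelfPartition_transpose, BlockLU.accessTo_eq,
      Matrix.transpose_transpose] using this
  · intro k hk hks
    obtain ⟨C, hC, hCk⟩ := hks.exists_isSingularClass
    obtain ⟨i, rfl⟩ := (hS.mem_iff C).1 hC
    have hi : i ∈ J ∪ K := hJK ▸ Finset.mem_univ i
    exact ⟨i, (Finset.mem_union.1 hi).resolve_left fun hiJ => hk ⟨i, hiJ, hCk⟩, hCk⟩
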